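/- Let $\mathbb N=\{1,2,\dots\}$ and $\mathbb Z_+=\{0,1,2,\dots\}$. For $f\colon\mathbb Z_+\to[0,\infty)$ let $$\Psi_f=\Bigl\{x\in\{0,1\}^{\mathbb Z_+}:\ \sum_{r=i}^{i+p-1}x_r\le f(p)\ \text{ for all } p,i\in\mathbb Z_+\Bigr\}$$ be the bounded density shift generated by $f$, with the shift map $\sigma$. Call $f$ canonical if $f(0)=0$, $f(m+1)-f(m)\in\mathbb Z_+$ and $f(m+n)\le f(m)+f(n)$ for all $m,n\in\mathbb Z_+$. Write $N(x,U)=\{n\in\mathbb N:\sigma^n x\in U\}$ and $[1]=\{x\in\Psi_f:x_0=1\}$; a point is transitive if its forward orbit is dense. A system $(X,T)$ is transitive (strongly mixing) if for all non-empty open $U,V\subseteq X$ the set $\{n\in\mathbb N: T^nU\cap V\neq\emptyset\}$ is non-empty (cofinite); it is an E-system if it is transitive and has an invariant Borel probability measure of full support; it has the multiple IP-recurrence property if for every non-empty open $U$, every $d\ge1$ and all sequences $(p^{(1)}_j)_j,\dots,(p^{(d)}_j)_j$ in $\mathbb N$ there is a non-empty finite set $\alpha$ of indices with $U\cap\bigcap_{i=1}^d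 T^{-\sum_{j\in\alpha}p^{(i)}_j}U\ne\emptyset$. A set $A\subseteq\mathbb N$ is a C-set if there are functions $\alpha$ and $H$, assigning to each non-empty finite set $F$ of sequences in $\mathbb N$ a number $\alpha(F)\in\mathbb N$ and a non-empty finite set $H(F)$ of indices, such that $\max H(F)<\min H(G)$ whenever $F\subsetneq G$, and $\sum_{i=1}^m\bigl(\alpha(G_i)+\sum_{t\in H(G_i)}g_i(t)\bigr)\in A$ whenever $m\ge1$, $G_1\subsetneq\dots\subsetneq G_m$ and $g_i\in G_i$ for all $i$. A set $A\subseteq\mathbb N$ has Banach density zero if its upper and lower Banach densities, i.e. the $\limsup$ and $\liminf$ of $\#(A\cap[M,N])/(N-M+1)$ as $N-M\to\infty$, are both $0$. Let $f$ be an unbounded canonical function. Then $(\Psi_f,\sigma)$ has the multiple IP-recurrence property, is strongly mixing and has a transitive point, and for every transitive point $x$ and every neighbourhood $U$ of $x$ the set $N(x,U)$ is a C-set. If moreover $f(n)/n\to0$, then: 1. $\lim_{n\to\infty}\frac1n\#\bigl(N(x,[1])\cap[1,n]\bigr)=0$ for every $x\in\Psi_f$; 2. the point mass at $0^\infty$ is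 the only $\sigma$-invariant Borel probability measure on $\Psi_f$; 3. $\Psi_f$ is uncountable, and $(\Psi_f,\sigma)$ is not an E-system; 4. every transitive point $x$ has a neighbourhood $V$ such that $N(x,V)$ has Banach density zero. This applies to the bounded density shift generated by $n\mapsto\log_2(n+1)$: it coincides with the one generated by $n\mapsto\lfloor\log_2(n+1)\rfloor$, which is an unbounded canonical function with $\lfloor\log_2(n+1)\rfloor/n\to0$. Consequently there exists a C-set in $\mathbb N$ of Banach density zero. -/

import Mathlib

open Filter Topology MeasureTheory
open scoped NNReal

/-! ### Topological dynamics

A dynamical system is given by a space `X` and a map `T : X → X`. Sets of positive integers are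
elements of `Set ℕ` all of whose members are at least `1`. -/

/-- `N(U,V) = {n ≥ 1 : T^n U ∩ V ≠ ∅}`. -/
def transferTimes {X : Type*} (T : X → X) (U V : Set X) : Set ℕ :=
  {n | 1 ≤ n ∧ (T^[n] '' U ∩ V).Nonempty}

/-- `N(x,U) = {n ≥ 1 : T^n x ∈ U}`. -/
def returnTimes {X : Type*} (T : X → X) (x : X) (U : Set X) : Set ℕ :=
  {n | 1 ≤ n ∧ T^[n] x ∈ U}

/-- `x` has a dense forward orbit. -/
def IsTransitivePoint {X : Type*} [TopologicalSpace X] (T : X → X) (x : X) : Prop :=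
  Dense (Set.range fun n : ℕ => T^[n] x)

def IsTransitiveSystem {X : Type*} [TopologicalSpace X] (T : X → X) : Prop :=
  ∀ U V : Set X, IsOpen U → IsOpen V → U.Nonempty → V.Nonempty → (transferTimes T U V).Nonempty

/-- `N(U,V)` is cofinite for all non-empty open `U`, `V`. -/
def IsStronglyMixing {X : Type*} [TopologicalSpace X] (T : X → X) : Prop :=
  ∀ U V : Set X, IsOpen U → IsOpen V → U.Nonempty → V.Nonempty → (transferTimes T U V)ᶜ.Finite

/-- A transitive system with an invariant Borel probability measure of full support. -/
def IsESystem {X : Type*} [TopologicalSpace X] [MeasurableSpace X] [BorelSpace X]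
    (T : X → X) : Prop :=
  IsTransitiveSystem T ∧
    ∃ μ : Measure X, IsProbabilityMeasure μ ∧ MeasurePreserving T μ μ ∧ μ.support = Set.univ

/-- For every non-empty open `U` and all IP-sets `FS(p⁽¹⁾), …, FS(p⁽ᵈ⁾)` there is a non-empty finite
`α` such that some `y ∈ U` has `T ^ (∑ j ∈ α, p⁽ⁱ⁾_j) y ∈ U` for all `i`. -/
def HasMultipleIPRecurrence {X : Type*} [TopologicalSpace X] (T : X → X) : Prop :=
  ∀ U : Set X, IsOpen U → U.Nonempty → ∀ d : ℕ, 1 ≤ d → ∀ p : Fin d → ℕ → ℕ+,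
    ∃ α : Finset ℕ, α.Nonempty ∧ (U ∩ ⋂ i : Fin d, T^[∑ j ∈ α, (p i j : ℕ)] ⁻¹' U).Nonempty

/-! ### Sets of integers -/

/-- The filter "`N - M → ∞`" on pairs `(M, N)` of non-negative integers. -/
noncomputable def longIntervals : Filter (ℕ × ℕ) :=
  comap (fun p : ℕ × ℕ => (p.2 : ℤ) - (p.1 : ℤ)) atTop

/-- `#(F ∩ [M,N]) / (N - M + 1)` for `p = (M, N)`. -/
noncomputable def intervalDensity (F : Set ℕ) (p : ℕ × ℕ) : ℝ :=
  ((F ∩ Set.Icc p.1 p.2).ncard : ℝ) / ((p.2 : ℝ) - (p.1 : ℝ) + 1)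

noncomputable def upperBanachDensity (F : Set ℕ) : ℝ :=
  limsup (intervalDensity F) longIntervals

noncomputable def lowerBanachDensity (F : Set ℕ) : ℝ :=
  liminf (intervalDensity F) longIntervals

/-- Both the upper and the lower Banach density of `F` are `0`. -/
def HasBanachDensityZero (F : Set ℕ) : Prop :=
  upperBanachDensity F = 0 ∧ lowerBanachDensity F = 0

/-- C-sets in the semigroup of positive integers: the sets `A` satisfying the conclusion of the
strong Central Sets Theorem of De, Hindman and Strauss. There are functions `α` and `H`, defined on
the non-empty finite sets of sequences of positive integers, with values in the positive integers
and in the non-empty finite sets of indices respectively, such that `max H(F) < min H(G)` if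
`F ⊊ G`, and `∑ i, (α(G_i) + ∑ t ∈ H(G_i), g_i(t)) ∈ A` for every chain `G_0 ⊊ … ⊊ G_m` and all
`g_i ∈ G_i`. (The values of `α` and `H` at the empty set play no role.) -/
def IsCSet (A : Set ℕ) : Prop :=
  ∃ (α : Finset (ℕ → ℕ+) → ℕ+) (H : Finset (ℕ → ℕ+) → Finset ℕ),
    (∀ F, F.Nonempty → (H F).Nonempty) ∧
    (∀ F G, F.Nonempty → F ⊂ G → ∀ s ∈ H F, ∀ t ∈ H G, s < t) ∧
    ∀ (m : ℕ) (G : Fin (m + 1) → Finset (ℕ → ℕ+)) (g : Fin (m + 1) → ℕ → ℕ+),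
      StrictMono G → (∀ i, g i ∈ G i) →
        ∑ i, ((α (G i) : ℕ) + ∑ t ∈ H (G i), (g i t : ℕ)) ∈ A

/-! ### Bounded density shifts -/

/-- The set `Ψ_f` of all 0-1 sequences in which every block of length `p` has at most `f p` ones. -/
def boundedDensityShift (f : ℕ → ℝ≥0) : Set (ℕ → Fin 2) :=
  {x | ∀ p i : ℕ, ((∑ r ∈ Finset.range p, (x (i + r) : ℕ) : ℕ) : ℝ≥0) ≤ f p}

/-- The left shift of 0-1 sequences. -/
def leftShift (x : ℕ → Fin 2) : ℕ → Fin 2 := fun n => x (n + 1)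

theorem leftShift_mapsTo (f : ℕ → ℝ≥0) :
    Set.MapsTo leftShift (boundedDensityShift f) (boundedDensityShift f) := by
  intro x hx p i
  have h := hx p (i + 1)
  simpa only [leftShift, add_right_comm] using h

/-- The shift map `σ` on `Ψ_f`. -/
def bdShift (f : ℕ → ℝ≥0) : boundedDensityShift f → boundedDensityShift f :=
  (leftShift_mapsTo f).restrict

/-- The fixed point `0^∞` of `Ψ_f`. -/
def zeroPoint (f : ℕ → ℝ≥0) : boundedDensityShift f :=
  ⟨fun _ => 0, by intro p i; simp⟩

/-- The cylinder `[1]` in `Ψ_f`. -/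
def oneCylinder (f : ℕ → ℝ≥0) : Set (boundedDensityShift f) := {x | x.1 0 = 1}

/-- Canonical functions `f : ℤ₊ → [0,∞)`. -/
structure IsCanonical (f : ℕ → ℝ≥0) : Prop where
  zero : f 0 = 0
  step : ∀ m, ∃ k : ℕ, f (m + 1) = f m + k
  subadd : ∀ m n, f (m + n) ≤ f m + f n

/-- The function `n ↦ log₂ (n + 1)`. -/
noncomputable def logFun (n : ℕ) : ℝ≥0 :=
  ⟨Real.logb 2 ((n : ℝ) + 1), Real.logb_nonneg one_lt_two (by simp)⟩

/-- The function `n ↦ ⌊log₂ (n + 1)⌋`. -/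
def floorLogFun (n : ℕ) : ℝ≥0 := (Nat.log 2 (n + 1) : ℝ≥0)

/-! ### Canonical functions -/

/-! Two opposite features of `f` carry the theorem. Unboundedness makes points of `Ψ_f` easy to
build. Given finitely many blocks of length `k`, choose `q` with `f q` at least the total block
length and write the blocks with gaps at least `q`. A window of length at least `q` sees no more
ones than `f q` allows; a shorter one meets only one block, itself taken from a point of `Ψ_f`
(`glue_mem`). Two blocks give strong mixing, hence transitive points by Baire. For multiple
IP-recurrence, copies of one block are glued at 0 and at the `d` sums over `α`, where `α` is chosen
so that any two positions coincide or are far apart (`exists_finset_sum_eq_zero_or_le_natAbs`). In a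
surjective system multiple IP-recurrence makes the return times of a transitive point a C-set, by
recursion over finite sets of sequences. Slow growth makes ones rare: every window of length `n` has
at most `f n` of them, so `f n / n → 0` bounds their frequency uniformly in the window and in the
point. This removes all invariant measures but the point mass at `0^∞` and gives the zero Banach
densities. The two features are compatible, as the logarithm shows. -/

theorem IsCanonical.monotone {f : ℕ → ℝ≥0} (hf : IsCanonical f) : Monotone f :=
  monotone_nat_of_le_succ fun n => by
    obtain ⟨k, hk⟩ := hf.step n
    rw [hk]
    exact le_self_add

/-- If `f 1 = 0`, subadditivity forces `f = 0`, which is bounded. -/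
theorem IsCanonical.one_le {f : ℕ → ℝ≥0} (hf : IsCanonical f) (hu : ¬ BddAbove (Set.range f)) :
    1 ≤ f 1 := by
  obtain ⟨k, hk⟩ := hf.step 0
  rw [hf.zero, zero_add, zero_add] at hk
  rcases Nat.eq_zero_or_pos k with rfl | hpos
  · refine absurd ⟨0, ?_⟩ hu
    rintro _ ⟨n, rfl⟩
    induction n with
    | zero => exact hf.zero.le
    | succ n ih =>
      refine (hf.subadd n 1).trans ?_
      simpa [hk] using ih
  · rw [hk]
    exact_mod_cast hpos

theorem exists_le_of_not_bddAbove {f : ℕ → ℝ≥0} (hu : ¬ BddAbove (Set.range f)) (C : ℝ≥0) :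
    ∃ q, C ≤ f q := by
  by_contra! h
  exact hu ⟨C, by rintro _ ⟨n, rfl⟩; exact (h n).le⟩

/-! ### Topology and points of bounded density shifts -/

theorem fin_two_val_le_one (a : Fin 2) : (a : ℕ) ≤ 1 := by omega

theorem isClosed_boundedDensityShift (f : ℕ → ℝ≥0) : IsClosed (boundedDensityShift f) := by
  have : boundedDensityShift f = ⋂ (p : ℕ) (i : ℕ), {x : ℕ → Fin 2 |
      ((∑ r ∈ Finset.range p, (x (i + r) : ℕ) : ℕ) : ℝ≥0) ≤ f p} := by
    ext x
    simp [boundedDensityShift]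
  rw [this]
  refine isClosed_iInter fun p => isClosed_iInter fun i => isClosed_le ?_ continuous_const
  refine continuous_of_discreteTopology.comp (continuous_finsetSum _ fun r _ => ?_)
  exact (continuous_of_discreteTopology (f := fun a : Fin 2 => (a : ℕ))).comp
    (continuous_apply (i + r))

theorem compactSpace_boundedDensityShift (f : ℕ → ℝ≥0) : CompactSpace (boundedDensityShift f) :=
  isCompact_iff_compactSpace.mp (isClosed_boundedDensityShift f).isCompact

theorem continuous_bdShift (f : ℕ → ℝ≥0) : Continuous (bdShift f) := by
  refine Continuous.subtype_mk ?_ _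
  refine continuous_pi fun n => ?_
  exact (continuous_apply (n + 1)).comp continuous_subtype_val

theorem bdShift_iterate_apply (f : ℕ → ℝ≥0) (n : ℕ) (x : boundedDensityShift f) (r : ℕ) :
    ((bdShift f)^[n] x).1 r = x.1 (n + r) := by
  induction n generalizing x with
  | zero => simp
  | succ n ih =>
    rw [Function.iterate_succ_apply, ih]
    change x.1 (n + r + 1) = _
    rw [add_right_comm]

theorem isOpen_coordinate_eq (f : ℕ → ℝ≥0) (j : ℕ) (a : Fin 2) :
    IsOpen {x : boundedDensityShift f | x.1 j = a} :=
  have h : Continuous fun x : boundedDensityShift f => x.1 j :=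
    (continuous_apply j).comp continuous_subtype_val
  (isOpen_discrete {a}).preimage h

/-- Every neighbourhood of `y` contains the cylinder of some initial block of `y`. -/
theorem exists_cylinder_subset {f : ℕ → ℝ≥0} {U : Set (boundedDensityShift f)}
    (hU : IsOpen U) {y : boundedDensityShift f} (hy : y ∈ U) :
    ∃ k₀ : ℕ, ∀ k ≥ k₀, ∀ z : boundedDensityShift f, (∀ r < k, z.1 r = y.1 r) → z ∈ U := by
  obtain ⟨W, hW, rfl⟩ := isOpen_induced_iff.mp hU
  obtain ⟨I, u, hu, hsub⟩ := isOpen_pi_iff.mp hW y.1 hy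
  refine ⟨I.sup id + 1, fun k hk z hz => hsub fun a ha => ?_⟩
  rw [hz a]
  · exact (hu a ha).2
  · have : a ≤ I.sup id := Finset.le_sup (f := id) ha
    omega

/-- Prepending a 0 stays in `Ψ_f`: a window starting at the new coordinate has the ones of a shorter
window, and `f` is monotone. -/
theorem surjective_bdShift {f : ℕ → ℝ≥0} (hf : IsCanonical f) :
    Function.Surjective (bdShift f) := by
  intro x
  refine ⟨⟨fun n => if n = 0 then 0 else x.1 (n - 1), fun p i => ?_⟩, ?_⟩
  · rcases i with _ | i
    · rcases p with _ | p
      · simp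
      · rw [Finset.sum_range_succ']
        refine le_trans ?_ (hf.monotone (Nat.le_succ p))
        simpa using x.2 p 0
    · refine le_trans (le_of_eq ?_) (x.2 p i)
      congr 1
      refine Finset.sum_congr rfl fun r _ => ?_
      have h1 : i + 1 + r ≠ 0 := by omega
      have h2 : i + 1 + r - 1 = i + r := by omega
      dsimp only
      rw [if_neg h1, h2]
  · apply Subtype.ext
    funext n
    change (if n + 1 = 0 then 0 else x.1 (n + 1 - 1)) = x.1 n
    simp

theorem nonempty_oneCylinder {f : ℕ → ℝ≥0} (hf : IsCanonical f)
    (hu : ¬ BddAbove (Set.range f)) : (oneCylinder f).Nonempty := by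
  refine ⟨⟨fun n => if n = 0 then 1 else 0, fun p i => ?_⟩, by simp [oneCylinder]⟩
  rcases Nat.eq_zero_or_pos p with rfl | hp
  · simp
  · refine le_trans ?_ ((hf.one_le hu).trans (hf.monotone hp))
    have : ∑ r ∈ Finset.range p, (((if i + r = 0 then 1 else 0 : Fin 2)) : ℕ) ≤ 1 := by
      calc _ ≤ ∑ r ∈ Finset.range p, (if r = 0 then 1 else 0) := by
            refine Finset.sum_le_sum fun r _ => ?_
            by_cases h : i + r = 0
            · have : r = 0 := by omega
              rw [if_pos h, if_pos this]
              rfl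
            · rw [if_neg h]
              exact Nat.zero_le _
        _ ≤ 1 := by
            rw [Finset.sum_ite_eq']
            split_ifs <;> simp
    exact_mod_cast this

/-! ### Gluing blocks at separated positions -/

/-- The sequence with the block `y n 0, …, y n (k - 1)` written at each position `n ∈ P`. -/
def glue (P : Finset ℕ) (k : ℕ) (y : ℕ → ℕ → Fin 2) (r : ℕ) : Fin 2 :=
  ∑ n ∈ P, if n ≤ r ∧ r < n + k then y n (r - n) else 0

/-- Addition in `Fin 2` is modulo 2, so reduction only lowers the value. The ones of a glued
sequence are thus at most the total over its blocks, overlapping or not. -/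
theorem fin_two_val_sum_le {ι : Type*} (s : Finset ι) (a : ι → Fin 2) :
    ((∑ i ∈ s, a i : Fin 2) : ℕ) ≤ ∑ i ∈ s, (a i : ℕ) := by
  classical
  induction s using Finset.induction_on with
  | empty => simp
  | insert i s hi ih =>
    rw [Finset.sum_insert hi, Finset.sum_insert hi, Fin.val_add]
    exact (Nat.mod_le _ _).trans (Nat.add_le_add_left ih _)

theorem glue_apply {P : Finset ℕ} {k : ℕ} (y : ℕ → ℕ → Fin 2)
    (hsep : ∀ m ∈ P, ∀ n ∈ P, m < n → m + k ≤ n) {n r : ℕ} (hn : n ∈ P) (hr : r < k) :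
    glue P k y (n + r) = y n r := by
  unfold glue
  rw [Finset.sum_eq_single_of_mem n hn]
  · simp [hr]
  · intro m hm hmn
    rw [if_neg]
    rintro ⟨h1, h2⟩
    rcases lt_or_gt_of_ne hmn with h | h
    · have := hsep m hm n hn h
      omega
    · have := hsep n hn m hm h
      omega

/-- The part of the window at or after position `n` is a window of `x` of length at most `p`;
cutting the block off at length `k` only removes ones. -/
theorem sum_block_le {f : ℕ → ℝ≥0} (hf : IsCanonical f) {x : ℕ → Fin 2}
    (hx : x ∈ boundedDensityShift f) (n k p i : ℕ) :
    ((∑ r ∈ Finset.range p,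
      ((if n ≤ i + r ∧ i + r < n + k then x (i + r - n) else 0 : Fin 2) : ℕ) : ℕ) : ℝ≥0) ≤ f p := by
  rcases le_total n i with h | h
  · refine le_trans ?_ (hx p (i - n))
    refine Nat.cast_le.mpr (Finset.sum_le_sum fun r _ => ?_)
    have : i + r - n = i - n + r := by omega
    rw [this]
    split_ifs <;> simp
  · rcases le_total p (n - i) with hp | hp
    · rw [Finset.sum_eq_zero]
      · simp
      · intro r hr
        rw [Finset.mem_range] at hr
        rw [if_neg (by omega)]
        rfl
    · obtain ⟨q, rfl⟩ := Nat.exists_eq_add_of_le hp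
      refine le_trans ?_ ((hx q 0).trans (hf.monotone (Nat.le_add_left q (n - i))))
      refine Nat.cast_le.mpr ?_
      rw [Finset.sum_range_add, Finset.sum_eq_zero, zero_add]
      · refine Finset.sum_le_sum fun r _ => ?_
        have : i + (n - i + r) - n = 0 + r := by omega
        rw [this]
        split_ifs <;> simp
      · intro r hr
        rw [Finset.mem_range] at hr
        rw [if_neg (by omega)]
        rfl

theorem sum_block_le_length (x : ℕ → Fin 2) (n k p i : ℕ) :
    ∑ r ∈ Finset.range p,
      ((if n ≤ i + r ∧ i + r < n + k then x (i + r - n) else 0 : Fin 2) : ℕ) ≤ k := by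
  calc _ ≤ ∑ r ∈ Finset.range p, (if n ≤ i + r ∧ i + r < n + k then 1 else 0) := by
        refine Finset.sum_le_sum fun r _ => ?_
        split_ifs
        · exact fin_two_val_le_one _
        · simp
    _ = ((Finset.range p).filter fun r => n ≤ i + r ∧ i + r < n + k).card := by
        rw [Finset.card_filter]
    _ ≤ (Finset.Ico n (n + k)).card := by
        refine Finset.card_le_card_of_injOn (fun r => i + r) ?_ ?_
        · intro r hr
          simpa using (Finset.mem_filter.mp hr).2
        · intro a _ b _ hab
          simpa using hab
    _ = k := by simp

/-- Windows of length at least `q` are controlled by the total block length, shorter ones by the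
single block they can meet. -/
theorem glue_mem {f : ℕ → ℝ≥0} (hf : IsCanonical f) {P : Finset ℕ} {k q : ℕ}
    {y : ℕ → ℕ → Fin 2} (hy : ∀ n ∈ P, y n ∈ boundedDensityShift f)
    (hq : ((P.card * k : ℕ) : ℝ≥0) ≤ f q)
    (hsep : ∀ m ∈ P, ∀ n ∈ P, m < n → m + (k + q) ≤ n) :
    glue P k y ∈ boundedDensityShift f := by
  intro p i
  set B : ℕ → ℕ := fun n => ∑ r ∈ Finset.range p,
    ((if n ≤ i + r ∧ i + r < n + k then y n (i + r - n) else 0 : Fin 2) : ℕ) with hB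
  have hle : ∑ r ∈ Finset.range p, (glue P k y (i + r) : ℕ) ≤ ∑ n ∈ P, B n := by
    rw [hB, Finset.sum_comm]
    exact Finset.sum_le_sum fun r _ => fin_two_val_sum_le _ _
  refine le_trans (Nat.cast_le.mpr hle) ?_
  rcases le_total q p with hqp | hpq
  · refine le_trans (Nat.cast_le.mpr ?_) (hq.trans (hf.monotone hqp))
    calc ∑ n ∈ P, B n ≤ ∑ _n ∈ P, k := Finset.sum_le_sum fun n _ => sum_block_le_length _ _ _ _ _
      _ = P.card * k := by simp
  · by_cases h0 : ∀ n ∈ P, B n = 0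
    · rw [Finset.sum_eq_zero h0]
      simp
    · push Not at h0
      obtain ⟨n, hn, hBn⟩ := h0
      -- A contributing block overlaps the window `[i, i + p)`. Since `p ≤ q`, two such blocks would
      -- violate the separation `k + q`.
      have key : ∀ m, B m ≠ 0 → m < i + p ∧ i < m + k := by
        intro m hm
        obtain ⟨r, hr, hne⟩ := Finset.exists_ne_zero_of_sum_ne_zero hm
        rw [Finset.mem_range] at hr
        by_cases hc : m ≤ i + r ∧ i + r < m + k
        · omega
        · rw [if_neg hc] at hne
          exact absurd rfl hne
      rw [Finset.sum_eq_single_of_mem n hn]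
      · exact sum_block_le hf (hy n hn) n k p i
      · intro m hm hmn
        by_contra hBm
        have h1 := key n hBn
        have h2 := key m hBm
        rcases lt_or_gt_of_ne hmn with h | h
        · have := hsep m hm n hn h
          omega
        · have := hsep n hn m hm h
          omega

/-! ### Strong mixing and its consequences -/

theorem isStronglyMixing_bdShift {f : ℕ → ℝ≥0} (hf : IsCanonical f)
    (hu : ¬ BddAbove (Set.range f)) : IsStronglyMixing (bdShift f) := by
  rintro U V hU hV ⟨u, hu'⟩ ⟨v, hv'⟩
  obtain ⟨k₁, hk₁⟩ := exists_cylinder_subset hU hu'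
  obtain ⟨k₂, hk₂⟩ := exists_cylinder_subset hV hv'
  set k := max k₁ k₂
  obtain ⟨q, hq⟩ := exists_le_of_not_bddAbove hu ((2 * k : ℕ) : ℝ≥0)
  -- The `+ 1` ensures `n ≥ 1` even if `k = q = 0`.
  refine (Set.finite_lt_nat (k + q + 1)).subset fun n hn => ?_
  by_contra hlt
  rw [Set.mem_ofPred_eq, not_lt] at hlt
  apply hn
  have hn0 : 0 ≠ n := by omega
  set y : ℕ → ℕ → Fin 2 := fun m => if m = 0 then u.1 else v.1
  have hsep : ∀ a ∈ ({0, n} : Finset ℕ), ∀ b ∈ ({0, n} : Finset ℕ), a < b → a + (k + q) ≤ b := by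
    intro a ha b hb hab
    simp only [Finset.mem_insert, Finset.mem_singleton] at ha hb
    omega
  have hz : glue {0, n} k y ∈ boundedDensityShift f := by
    refine glue_mem hf (q := q) ?_ ?_ hsep
    · intro m _
      by_cases h : m = 0
      · simp [y, h]
      · simp [y, h]
    · rwa [Finset.card_pair hn0]
  have happ : ∀ m ∈ ({0, n} : Finset ℕ), ∀ r < k, glue {0, n} k y (m + r) = y m r :=
    fun m hm r hr => glue_apply y (fun a ha b hb hab => by have := hsep a ha b hb hab; omega) hm hr
  refine ⟨by omega, _, ⟨⟨_, hz⟩, ?_, rfl⟩, ?_⟩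
  · refine hk₁ k (le_max_left _ _) _ fun r hr => ?_
    have := happ 0 (by simp) r hr
    simpa [y] using this
  · refine hk₂ k (le_max_right _ _) _ fun r hr => ?_
    rw [bdShift_iterate_apply]
    have := happ n (by simp) r hr
    simpa [y, hn0.symm] using this

theorem IsStronglyMixing.isTransitiveSystem {X : Type*} [TopologicalSpace X] {T : X → X}
    (h : IsStronglyMixing T) : IsTransitiveSystem T := by
  intro U V hU hV hU' hV'
  have := (h U V hU hV hU' hV').infinite_compl.nonempty
  rwa [compl_compl] at this

/-- Birkhoff's argument: for each basic open `V` the points whose orbit meets `V` form a dense open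
set, and Baire's theorem intersects countably many of these. -/
theorem IsTransitiveSystem.exists_isTransitivePoint {X : Type*} [TopologicalSpace X]
    [BaireSpace X] [SecondCountableTopology X] [Nonempty X] {T : X → X} (hT : Continuous T)
    (h : IsTransitiveSystem T) : ∃ x, IsTransitivePoint T x := by
  set S := TopologicalSpace.countableBasis X
  have hd : Dense (⋂ V ∈ S, ⋃ n : ℕ, T^[n] ⁻¹' V) := by
    refine dense_biInter_of_isOpen (fun V hV => isOpen_iUnion fun n =>
      (TopologicalSpace.isOpen_of_mem_countableBasis hV).preimage (hT.iterate n))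
      (TopologicalSpace.countable_countableBasis X) fun V hV => ?_
    refine dense_iff_inter_open.mpr fun U hU hU' => ?_
    obtain ⟨n, -, _, ⟨z, hz, rfl⟩, hzV⟩ := h U V hU
      (TopologicalSpace.isOpen_of_mem_countableBasis hV) hU'
      (TopologicalSpace.nonempty_of_mem_countableBasis hV)
    exact ⟨z, hz, Set.mem_iUnion.mpr ⟨n, hzV⟩⟩
  obtain ⟨x, hx⟩ := hd.nonempty
  refine ⟨x, (TopologicalSpace.isBasis_countableBasis X).dense_iff.mpr fun V hV _ => ?_⟩
  obtain ⟨n, hn⟩ := Set.mem_iUnion.mp (Set.mem_iInter₂.mp hx V hV)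
  exact ⟨_, hn, n, rfl⟩

/-- A countable compact Hausdorff space has an isolated point `x`. Mixing of `{x}` with the
cylinders of 1 and of 0 gives a common time `n`, so `x` would have both symbols at coordinate `n`.
-/
theorem not_countable_boundedDensityShift {f : ℕ → ℝ≥0} (hf : IsCanonical f)
    (hu : ¬ BddAbove (Set.range f)) : ¬ (boundedDensityShift f).Countable := by
  intro hc
  have := hc.to_subtype
  have := compactSpace_boundedDensityShift f
  have : Nonempty (boundedDensityShift f) := ⟨zeroPoint f⟩
  obtain ⟨x, hx⟩ := nonempty_interior_of_iUnion_of_closed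
    (f := fun x : boundedDensityShift f => ({x} : Set (boundedDensityShift f)))
    (fun x => isClosed_singleton) (Set.iUnion_of_singleton _)
  have hmix := isStronglyMixing_bdShift hf hu
  have h1 := hmix _ _ isOpen_interior (isOpen_coordinate_eq f 0 1) hx (nonempty_oneCylinder hf hu)
  have h0 := hmix _ _ isOpen_interior (isOpen_coordinate_eq f 0 0) hx ⟨zeroPoint f, rfl⟩
  obtain ⟨n, hn⟩ := (h1.union h0).infinite_compl.nonempty
  rw [← Set.compl_inter, compl_compl] at hn
  obtain ⟨⟨-, _, ⟨a, ha, rfl⟩, ha'⟩, -, _, ⟨b, hb, rfl⟩, hb'⟩ := hn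
  have ha2 : a = x := Set.mem_singleton_iff.mp (interior_subset ha)
  have hb2 : b = x := Set.mem_singleton_iff.mp (interior_subset hb)
  rw [ha2, Set.mem_ofPred_eq] at ha'
  rw [hb2, Set.mem_ofPred_eq, ha'] at hb'
  exact absurd hb' (by decide)

/-! ### Multiple IP-recurrence -/

/-- Along an ultrafilter an integer sequence is constant or escapes every ball. -/
theorem Ultrafilter.eventually_eq_or_forall_le_natAbs (F : Ultrafilter ℕ) (v : ℕ → ℤ) :
    (∃ a, ∀ᶠ j in (F : Filter ℕ), v j = a) ∨
      ∀ L : ℕ, ∀ᶠ j in (F : Filter ℕ), L ≤ (v j).natAbs := by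
  by_contra! h
  obtain ⟨h1, L, hL⟩ := h
  have hL' : ∀ᶠ j in (F : Filter ℕ), v j ∈ Finset.Icc (-(L : ℤ)) L := by
    refine hL.mono fun j hj => ?_
    rw [Finset.mem_Icc]
    omega
  have hall : ∀ᶠ j in (F : Filter ℕ), ∀ a ∈ Finset.Icc (-(L : ℤ)) L, v j ≠ a :=
    (Filter.eventually_all_finset _).mpr fun a _ => h1 a
  obtain ⟨j, hj, hj'⟩ := (hL'.and hall).exists
  exact hj' _ hj rfl

/-- Along a non-principal ultrafilter each `v c` is constant or escapes. Take `L` indices where the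
constant ones have their limit value, then one more such index so far out that each escaping `v c`
outweighs its previous sum by `L`. A constant `a` sums to `(L + 1) * a`, which is 0 or large. -/
theorem exists_finset_sum_eq_zero_or_le_natAbs {ι : Type*} [Finite ι] (v : ι → ℕ → ℤ) (L : ℕ) :
    ∃ s : Finset ℕ, s.Nonempty ∧
      ∀ c, ∑ j ∈ s, v c j = 0 ∨ L ≤ (∑ j ∈ s, v c j).natAbs := by
  set F : Ultrafilter ℕ := Filter.hyperfilter ℕ
  have hgood : ∀ᶠ j in (F : Filter ℕ), ∀ c, ∀ a, (∀ᶠ i in (F : Filter ℕ), v c i = a) → v c j = a := by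
    refine Filter.eventually_all.mpr fun c => ?_
    by_cases h : ∃ a, ∀ᶠ i in (F : Filter ℕ), v c i = a
    · obtain ⟨a, ha⟩ := h
      filter_upwards [ha] with j hj b hb
      obtain ⟨i, hi, hi'⟩ := (ha.and hb).exists
      rw [hj, ← hi, hi']
    · exact Filter.Eventually.of_forall fun j a ha => absurd ⟨a, ha⟩ h
  have hinf : {j | ∀ c, ∀ a, (∀ᶠ i in (F : Filter ℕ), v c i = a) → v c j = a}.Infinite :=
    fun hfin => Filter.notMem_hyperfilter_of_finite hfin hgood
  obtain ⟨s, hs, hcard⟩ := hinf.exists_subset_card_eq L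
  have hnot : ∀ᶠ j in (F : Filter ℕ), j ∉ s :=
    Filter.compl_mem_hyperfilter_of_finite s.finite_toSet
  have hfar : ∀ᶠ j in (F : Filter ℕ), ∀ c, (∃ a, ∀ᶠ i in (F : Filter ℕ), v c i = a) ∨
      L + (∑ j ∈ s, v c j).natAbs ≤ (v c j).natAbs := by
    refine Filter.eventually_all.mpr fun c => ?_
    rcases F.eventually_eq_or_forall_le_natAbs (v c) with h | h
    · exact Filter.Eventually.of_forall fun j => Or.inl h
    · exact (h _).mono fun j hj => Or.inr hj
  obtain ⟨j, ⟨hj, hjs⟩, hjf⟩ := ((hgood.and hnot).and hfar).exists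
  refine ⟨insert j s, Finset.insert_nonempty _ _, fun c => ?_⟩
  rcases hjf c with ⟨a, ha⟩ | h
  · have hsum : ∑ i ∈ insert j s, v c i = (L + 1 : ℕ) * a := by
      rw [Finset.sum_congr rfl (g := fun _ => a), Finset.sum_const, Finset.card_insert_of_notMem hjs,
        hcard, nsmul_eq_mul]
      intro i hi
      rcases Finset.mem_insert.mp hi with rfl | hi
      · exact hj c a ha
      · exact hs hi c a ha
    rw [hsum, Int.natAbs_mul, Int.natAbs_natCast]
    rcases eq_or_ne a 0 with rfl | h0
    · simp
    · right
      have : 1 ≤ a.natAbs := Int.natAbs_pos.mpr h0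
      nlinarith
  · right
    rw [Finset.sum_insert hjs]
    omega

/-- All `d + 1` positions receive the same block of `u`, so coinciding positions do no harm; only
nearby distinct ones must be avoided. This is the dichotomy for the pairwise differences of the
sums. -/
theorem hasMultipleIPRecurrence_bdShift {f : ℕ → ℝ≥0} (hf : IsCanonical f)
    (hu : ¬ BddAbove (Set.range f)) : HasMultipleIPRecurrence (bdShift f) := by
  rintro U hU ⟨u, hu'⟩ d - p
  obtain ⟨k, hk⟩ := exists_cylinder_subset hU hu'
  obtain ⟨q, hq⟩ := exists_le_of_not_bddAbove hu (((d + 1) * k : ℕ) : ℝ≥0)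
  -- the extra index `none` stands for the position `0`
  let t : Option (Fin d) → ℕ → ℕ := fun a j => a.elim 0 fun i => (p i j : ℕ)
  obtain ⟨s, hs, hsum⟩ := exists_finset_sum_eq_zero_or_le_natAbs
    (fun (c : Option (Fin d) × Option (Fin d)) j => (t c.1 j : ℤ) - t c.2 j) (k + q)
  let pos : Option (Fin d) → ℕ := fun a => ∑ j ∈ s, t a j
  let P : Finset ℕ := Finset.univ.image pos
  have hsep : ∀ m ∈ P, ∀ n ∈ P, m < n → m + (k + q) ≤ n := by
    intro m hm n hn hmn
    obtain ⟨a, -, rfl⟩ := Finset.mem_image.mp hm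
    obtain ⟨b, -, rfl⟩ := Finset.mem_image.mp hn
    have h := hsum (a, b)
    rw [Finset.sum_sub_distrib, ← Nat.cast_sum, ← Nat.cast_sum] at h
    change (pos a : ℤ) - pos b = 0 ∨ _ ≤ ((pos a : ℤ) - pos b).natAbs at h
    omega
  have hz : glue P k (fun _ => u.1) ∈ boundedDensityShift f := by
    refine glue_mem hf (q := q) (fun _ _ => u.2) (le_trans (Nat.cast_le.mpr ?_) hq) hsep
    refine Nat.mul_le_mul_right _ (Finset.card_image_le.trans ?_)
    simp
  have happ : ∀ a, ∀ r < k, glue P k (fun _ => u.1) (pos a + r) = u.1 r :=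
    fun a r hr => glue_apply _ (fun a ha b hb hab => by have := hsep a ha b hb hab; omega)
      (Finset.mem_image_of_mem pos (Finset.mem_univ a)) hr
  refine ⟨s, hs, ⟨_, hz⟩, hk k le_rfl _ fun r hr => ?_, Set.mem_iInter.mpr fun i => ?_⟩
  · simpa [pos, t] using happ none r hr
  · refine hk k le_rfl _ fun r hr => ?_
    rw [bdShift_iterate_apply]
    exact happ (some i) r hr

/-! ### C-sets -/

/-- A set with the following extension property is a C-set: each finite set `S` of its
elements, each finite set of sequences and each bound on indices admit `a` and `H` such that
`A` contains all `a + ∑ t ∈ H, g t` and their sums with elements of `S`. -/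
theorem isCSet_of_forall_exists {A : Set ℕ}
    (hA : ∀ (S : Finset ℕ), (∀ s ∈ S, s ∈ A) → ∀ F : Finset (ℕ → ℕ+), F.Nonempty → ∀ K : ℕ,
      ∃ (a : ℕ+) (H : Finset ℕ), H.Nonempty ∧ (∀ t ∈ H, K < t) ∧
        ∀ s ∈ insert 0 S, ∀ g ∈ F, s + ((a : ℕ) + ∑ t ∈ H, (g t : ℕ)) ∈ A) :
    IsCSet A := by
  classical
  have hstep : ∀ (S : Finset ℕ) (F : Finset (ℕ → ℕ+)) (K : ℕ), ∃ D : ℕ+ × Finset ℕ,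
      (∀ s ∈ S, s ∈ A) → F.Nonempty → D.2.Nonempty ∧ (∀ t ∈ D.2, K < t) ∧
        ∀ s ∈ insert 0 S, ∀ g ∈ F, s + ((D.1 : ℕ) + ∑ t ∈ D.2, (g t : ℕ)) ∈ A := by
    intro S F K
    by_cases h : (∀ s ∈ S, s ∈ A) ∧ F.Nonempty
    · obtain ⟨a, H, hH⟩ := hA S h.1 F h.2 K
      exact ⟨(a, H), fun _ _ => hH⟩
    -- A default value makes `D` total, so the recursion can be run before its sums are known to lie
    -- in `A`.
    · exact ⟨(1, ∅), fun h1 h2 => absurd ⟨h1, h2⟩ h⟩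
  choose D hD using hstep
  -- the sums and the index bound contributed by the proper non-empty subsets of `F`
  let prevSums (F : Finset (ℕ → ℕ+)) (E : ∀ G ⊂ F, (ℕ+ × Finset ℕ) × Finset ℕ) : Finset ℕ :=
    F.ssubsets.attach.biUnion fun G => (E G.1 (Finset.mem_ssubsets.mp G.2)).2
  let bound (F : Finset (ℕ → ℕ+)) (E : ∀ G ⊂ F, (ℕ+ × Finset ℕ) × Finset ℕ) : ℕ :=
    F.ssubsets.attach.sup fun G => (E G.1 (Finset.mem_ssubsets.mp G.2)).1.2.sup id
  -- The first component of `E F` is the pair of values of `α` and `H` at `F`; the second collects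
  -- all sums over chains with top `F`.
  let E : Finset (ℕ → ℕ+) → (ℕ+ × Finset ℕ) × Finset ℕ :=
    Finset.strongInduction fun F E =>
      let d := D (prevSums F E) F (bound F E)
      (d, Finset.image₂ (fun s (g : ℕ → ℕ+) => s + ((d.1 : ℕ) + ∑ t ∈ d.2, (g t : ℕ)))
        (insert 0 (prevSums F E)) F)
  let S (F : Finset (ℕ → ℕ+)) : Finset ℕ := prevSums F fun G _ => E G
  let K (F : Finset (ℕ → ℕ+)) : ℕ := bound F fun G _ => E G
  have hE : ∀ F, E F = (D (S F) F (K F),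
      Finset.image₂ (fun s (g : ℕ → ℕ+) => s + (((D (S F) F (K F)).1 : ℕ) +
        ∑ t ∈ (D (S F) F (K F)).2, (g t : ℕ))) (insert 0 (S F)) F) :=
    fun F => Finset.strongInduction_eq _ F
  have hS : ∀ F s, s ∈ S F ↔ ∃ G ⊂ F, s ∈ (E G).2 := by
    intro F s
    simp [S, prevSums]
  have hK : ∀ F G, G ⊂ F → ∀ t ∈ (E G).1.2, t ≤ K F := by
    intro F G hGF t ht
    have h1 : t ≤ (E G).1.2.sup id := Finset.le_sup (f := id) ht
    exact h1.trans (Finset.le_sup (f := fun G : F.ssubsets => (E G.1).1.2.sup id)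
      (Finset.mem_attach _ ⟨G, Finset.mem_ssubsets.mpr hGF⟩))
  have hEA : ∀ F, ∀ s ∈ (E F).2, s ∈ A := by
    intro F
    induction F using Finset.strongInduction with
    | H F ih =>
      intro s hs
      rw [hE] at hs
      obtain ⟨s', hs', g, hg, rfl⟩ := Finset.mem_image₂.mp hs
      refine (hD (S F) F (K F) ?_ ⟨g, hg⟩).2.2 s' hs' g hg
      intro r hr
      obtain ⟨G, hG, hrG⟩ := (hS F r).mp hr
      exact ih G hG r hrG
  have hspec : ∀ F : Finset (ℕ → ℕ+), F.Nonempty →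
      (E F).1.2.Nonempty ∧ ∀ t ∈ (E F).1.2, K F < t := by
    intro F hF
    have h := hD (S F) F (K F) (fun r hr => by
      obtain ⟨G, -, hrG⟩ := (hS F r).mp hr
      exact hEA G r hrG) hF
    rw [hE]
    exact ⟨h.1, h.2.1⟩
  refine ⟨fun F => (E F).1.1, fun F => (E F).1.2, fun F hF => (hspec F hF).1, ?_, ?_⟩
  · intro F G hF hFG s hs t ht
    exact (hK G F hFG s hs).trans_lt ((hspec G (hF.mono hFG.subset)).2 t ht)
  · intro m G g hG hg
    -- Membership in the sums attached to the top of the chain is stronger than membership in `A`,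
    -- and is what the induction on chain length needs.
    refine hEA (G (Fin.last m)) _ ?_
    induction m with
    | zero =>
      rw [hE, Fin.sum_univ_one]
      refine Finset.mem_image₂.mpr ⟨0, Finset.mem_insert_self _ _, g 0, hg 0, ?_⟩
      simp only [zero_add, hE]
      rfl
    | succ m ih =>
      have h := ih (fun i => G i.castSucc) (fun i => g i.castSucc)
        (fun i j hij => hG (Fin.castSucc_lt_castSucc_iff.mpr hij)) (fun i => hg _)
      rw [Fin.sum_univ_castSucc, hE (G (Fin.last (m + 1)))]
      refine Finset.mem_image₂.mpr ⟨_, Finset.mem_insert_of_mem ((hS _ _).mpr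
        ⟨_, hG (Fin.castSucc_lt_last _), h⟩), g (Fin.last (m + 1)), hg _, ?_⟩
      simp only [hE (G (Fin.last (m + 1)))]

/-- Return times of a transitive point to its neighbourhoods are C-sets in a surjective system
with multiple IP-recurrence. -/
theorem HasMultipleIPRecurrence.isCSet_returnTimes {X : Type*} [TopologicalSpace X] {T : X → X}
    (hT : Continuous T) (hsurj : Function.Surjective T) (hrec : HasMultipleIPRecurrence T)
    {x : X} (hx : IsTransitivePoint T x) {U : Set X} (hU : U ∈ 𝓝 x) :
    IsCSet (returnTimes T x U) := by
  classical
  obtain ⟨O, hOU, hO, hxO⟩ := mem_nhds_iff.mp hU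
  have key : IsCSet (returnTimes T x O) := by
    refine isCSet_of_forall_exists fun S hS F hF K => ?_
    -- Landing in `V` means being in `O` now and after each earlier time in `S`; `x ∈ V` because `S`
    -- consists of return times.
    let V : Set X := ⋂ s ∈ insert 0 S, T^[s] ⁻¹' O
    have hV : IsOpen V := isOpen_biInter_finset fun s _ => hO.preimage (hT.iterate s)
    have hxV : x ∈ V := by
      refine Set.mem_iInter₂.mpr fun s hs => ?_
      rcases Finset.mem_insert.mp hs with rfl | hs
      · exact hxO
      · exact (hS s hs).2
    let e := F.equivFin
    -- Shifting the sequences by `K + 1` pushes the chosen indices beyond `K`.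
    obtain ⟨H, hH, y, hyV, hy⟩ := hrec V hV ⟨x, hxV⟩ F.card hF.card_pos
      fun i j => (e.symm i).1 (j + (K + 1))
    let W : Set X := ⋂ i : Fin F.card,
      T^[∑ j ∈ H, ((e.symm i).1 (j + (K + 1)) : ℕ)] ⁻¹' V
    have hW : IsOpen W := isOpen_iInter_of_finite fun i => hV.preimage (hT.iterate _)
    -- Entering `T ⁻¹' W` at time `n ≥ 0` means entering `W` at time `n + 1`, which is positive as
    -- `a` must be. Surjectivity makes this preimage non-empty.
    obtain ⟨y', rfl⟩ := hsurj y
    obtain ⟨_, hn, n, rfl⟩ := hx.inter_open_nonempty (T ⁻¹' W) (hW.preimage hT) ⟨y', hy⟩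
    refine ⟨⟨n + 1, n.succ_pos⟩, H.map (addRightEmbedding (K + 1)), hH.map, ?_, ?_⟩
    · intro t ht
      obtain ⟨j, -, rfl⟩ := Finset.mem_map.mp ht
      simp only [addRightEmbedding_apply]
      omega
    · intro s hs g hg
      have h1 := Set.mem_iInter.mp hn (e ⟨g, hg⟩)
      rw [Equiv.symm_apply_apply] at h1
      have h2 := Set.mem_iInter₂.mp h1 s hs
      rw [Set.mem_preimage, ← Function.iterate_succ_apply' T, ← Function.iterate_add_apply,
        ← Function.iterate_add_apply] at h2
      rw [Finset.sum_map]
      simp only [addRightEmbedding_apply, PNat.mk_coe]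
      refine ⟨by omega, ?_⟩
      convert h2 using 2
      dsimp only
      omega
  obtain ⟨α, H, h1, h2, h3⟩ := key
  exact ⟨α, H, h1, h2, fun m G g hG hg => ⟨(h3 m G g hG hg).1, hOU (h3 m G g hG hg).2⟩⟩

/-! ### Slow growth -/

/-- The elements of `B` in a window of length `n` inject into the ones of `x` in that window moved
by `j`. The offset allows for neighbourhoods fixing a 1 at coordinate `j`. -/
theorem ncard_ones_le {f : ℕ → ℝ≥0} {x : ℕ → Fin 2} (hx : x ∈ boundedDensityShift f)
    (B : Set ℕ) (j M n : ℕ) (hB : ∀ r ∈ B, x (r + j) = 1) :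
    ((B ∩ Set.Ico M (M + n)).ncard : ℝ) ≤ f n := by
  classical
  have hsub : B ∩ Set.Ico M (M + n) ⊆
      (((Finset.range n).filter fun r => x (M + j + r) = 1).image fun r => M + r : Finset ℕ) := by
    rintro r ⟨hr, hr1, hr2⟩
    simp only [Finset.coe_image, Finset.coe_filter, Finset.mem_range, Set.mem_image,
      Set.mem_ofPred_eq]
    refine ⟨r - M, ⟨by omega, ?_⟩, by omega⟩
    rw [← hB r hr]
    congr 1
    omega
  have h1 := Set.ncard_le_ncard hsub (Finset.finite_toSet _)
  rw [Set.ncard_coe_finset] at h1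
  have h2 : ((Finset.range n).filter fun r => x (M + j + r) = 1).card ≤
      ∑ r ∈ Finset.range n, (x (M + j + r) : ℕ) := by
    rw [Finset.card_filter]
    refine Finset.sum_le_sum fun r _ => ?_
    split_ifs with h
    · simp [h]
    · simp
  have h3 := hx n (M + j)
  have h4 : ((B ∩ Set.Ico M (M + n)).ncard : ℝ≥0) ≤ f n :=
    le_trans (Nat.cast_le.mpr ((h1.trans Finset.card_image_le).trans h2)) h3
  exact_mod_cast h4

theorem tendsto_ncard_returnTimes_div {f : ℕ → ℝ≥0}
    (hslow : Tendsto (fun n : ℕ => (f n : ℝ) / n) atTop (𝓝 0)) (x : boundedDensityShift f) :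
    Tendsto (fun n : ℕ =>
      ((returnTimes (bdShift f) x (oneCylinder f) ∩ Set.Icc 1 n).ncard : ℝ) / n) atTop (𝓝 0) := by
  refine squeeze_zero (fun n => by positivity) (fun n => ?_) hslow
  have h := ncard_ones_le x.2 (returnTimes (bdShift f) x (oneCylinder f)) 0 1 n fun r hr => by
    rw [← bdShift_iterate_apply]
    exact hr.2
  have hI : Set.Ico 1 (1 + n) = Set.Icc 1 n := by
    ext r
    simp only [Set.mem_Ico, Set.mem_Icc]
    omega
  rw [hI] at h
  gcongr

/-- Integrate `x_0 + ⋯ + x_{n-1} ≤ f n`: by invariance the left side gives `n * μ [1]`, so `μ [1] ≤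
f n / n → 0`. -/
theorem measure_oneCylinder_eq_zero {f : ℕ → ℝ≥0}
    (hslow : Tendsto (fun n : ℕ => (f n : ℝ) / n) atTop (𝓝 0))
    (μ : Measure (boundedDensityShift f)) [IsProbabilityMeasure μ]
    (hμ : MeasurePreserving (bdShift f) μ μ) : μ (oneCylinder f) = 0 := by
  classical
  have hmeas : MeasurableSet (oneCylinder f) := (isOpen_coordinate_eq f 0 1).measurableSet
  have hle : ∀ n : ℕ, (n : ENNReal) * μ (oneCylinder f) ≤ f n := by
    intro n
    have hmp : ∀ r, μ ((bdShift f)^[r] ⁻¹' oneCylinder f) = μ (oneCylinder f) := fun r =>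
      (hμ.iterate r).measure_preimage hmeas.nullMeasurableSet
    calc (n : ENNReal) * μ (oneCylinder f)
        = ∑ r ∈ Finset.range n, μ ((bdShift f)^[r] ⁻¹' oneCylinder f) := by simp [hmp]
      _ = ∑ r ∈ Finset.range n,
            ∫⁻ x, ((bdShift f)^[r] ⁻¹' oneCylinder f).indicator 1 x ∂μ := by
          refine Finset.sum_congr rfl fun r _ => ?_
          rw [lintegral_indicator_one ((hμ.iterate r).measurable hmeas)]
      _ = ∫⁻ x, ∑ r ∈ Finset.range n, ((bdShift f)^[r] ⁻¹' oneCylinder f).indicator 1 x ∂μ := by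
          rw [lintegral_finsetSum]
          exact fun r _ => measurable_one.indicator ((hμ.iterate r).measurable hmeas)
      _ ≤ ∫⁻ _, f n ∂μ := by
          refine lintegral_mono fun x => ?_
          have h := x.2 n 0
          have h' : (((∑ r ∈ Finset.range n, (x.1 (0 + r) : ℕ) : ℕ) : ℝ≥0) : ENNReal) ≤ f n :=
            ENNReal.coe_le_coe.mpr h
          refine le_trans ?_ h'
          push_cast
          refine Finset.sum_le_sum fun r _ => ?_
          rw [Set.indicator_apply]
          split_ifs with hr
          · have : x.1 (0 + r) = 1 := by
              rw [zero_add, ← add_zero r, ← bdShift_iterate_apply]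
              exact hr
            rw [this]
            simp
          · simp
      _ = f n := by simp
  have hreal : ∀ n : ℕ, 1 ≤ n → μ.real (oneCylinder f) ≤ (f n : ℝ) / n := by
    intro n hn
    rw [le_div_iff₀ (by exact_mod_cast hn), mul_comm]
    have h := ENNReal.toReal_mono ENNReal.coe_ne_top (hle n)
    simpa [Measure.real] using h
  have h0 : μ.real (oneCylinder f) ≤ 0 :=
    ge_of_tendsto hslow ((eventually_ge_atTop 1).mono hreal)
  exact (measureReal_eq_zero_iff).mp (le_antisymm h0 measureReal_nonneg)

theorem measurePreserving_bdShift_iff {f : ℕ → ℝ≥0}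
    (hslow : Tendsto (fun n : ℕ => (f n : ℝ) / n) atTop (𝓝 0))
    (μ : Measure (boundedDensityShift f)) [IsProbabilityMeasure μ] :
    MeasurePreserving (bdShift f) μ μ ↔ μ = Measure.dirac (zeroPoint f) := by
  have hm : Measurable (bdShift f) := (continuous_bdShift f).measurable
  constructor
  · intro hμ
    have h0 := measure_oneCylinder_eq_zero hslow μ hμ
    have hae : ∀ᵐ x ∂μ, x = zeroPoint f := by
      have hall : ∀ᵐ x ∂μ, ∀ r, (bdShift f)^[r] x ∉ oneCylinder f := by
        refine ae_all_iff.mpr fun r => ?_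
        exact (hμ.iterate r).quasiMeasurePreserving.ae (measure_eq_zero_iff_ae_notMem.mp h0)
      filter_upwards [hall] with x hx
      apply Subtype.ext
      funext r
      have h := hx r
      change ¬ ((bdShift f)^[r] x).1 0 = 1 at h
      rw [bdShift_iterate_apply, add_zero] at h
      change x.1 r = 0
      omega
    -- The identity and the constant map agree almost everywhere, so their push-forwards `μ` and the
    -- point mass are equal.
    have hmap : μ.map id = μ.map fun _ => zeroPoint f := Measure.map_congr hae
    rw [Measure.map_id, Measure.map_const, measure_univ, one_smul] at hmap
    exact hmap
  · rintro rfl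
    refine ⟨hm, ?_⟩
    rw [Measure.map_dirac' hm]
    rfl

theorem not_isESystem_bdShift {f : ℕ → ℝ≥0} (hf : IsCanonical f)
    (hu : ¬ BddAbove (Set.range f)) (hslow : Tendsto (fun n : ℕ => (f n : ℝ) / n) atTop (𝓝 0)) :
    ¬ IsESystem (bdShift f) := by
  rintro ⟨-, μ, hprob, hμ, hsupp⟩
  obtain ⟨x, hx⟩ := nonempty_oneCylinder hf hu
  have hxs : x ∈ μ.support := hsupp ▸ Set.mem_univ x
  have hpos := (Measure.mem_support_iff_forall x).mp hxs _
    ((isOpen_coordinate_eq f 0 1).mem_nhds hx)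
  exact hpos.ne' (measure_oneCylinder_eq_zero hslow μ hμ)

instance longIntervals_neBot : longIntervals.NeBot := by
  refine comap_neBot fun t ht => ?_
  obtain ⟨a, ha⟩ := mem_atTop_sets.mp ht
  exact ⟨(0, a.toNat), ha _ (by simp)⟩

theorem HasBanachDensityZero.of_tendsto {B : Set ℕ}
    (h : Tendsto (intervalDensity B) longIntervals (𝓝 0)) : HasBanachDensityZero B :=
  ⟨h.limsup_eq, h.liminf_eq⟩

/-- A dense orbit visits `[1]`, so `x` has a 1 at some coordinate `j`. Prescribing that 1 gives `V`:
returns to it are ones of `x`, counted by `f` uniformly over windows. -/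
theorem exists_nhds_hasBanachDensityZero {f : ℕ → ℝ≥0} (hf : IsCanonical f)
    (hu : ¬ BddAbove (Set.range f)) (hslow : Tendsto (fun n : ℕ => (f n : ℝ) / n) atTop (𝓝 0))
    {x : boundedDensityShift f} (hx : IsTransitivePoint (bdShift f) x) :
    ∃ V ∈ 𝓝 x, HasBanachDensityZero (returnTimes (bdShift f) x V) := by
  obtain ⟨_, hj, j, rfl⟩ := hx.inter_open_nonempty _ (isOpen_coordinate_eq f 0 1)
    (nonempty_oneCylinder hf hu)
  rw [Set.mem_ofPred_eq, bdShift_iterate_apply, add_zero] at hj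
  refine ⟨_, (isOpen_coordinate_eq f j 1).mem_nhds hj, HasBanachDensityZero.of_tendsto ?_⟩
  set B := returnTimes (bdShift f) x {y | y.1 j = 1}
  have hlen : Tendsto (fun p : ℕ × ℕ => ((p.2 : ℤ) - (p.1 : ℤ) + 1).toNat) longIntervals atTop := by
    have h1 : Tendsto (fun p : ℕ × ℕ => (p.2 : ℤ) - (p.1 : ℤ)) longIntervals atTop :=
      tendsto_comap
    have h2 : Tendsto (fun a : ℤ => (a + 1).toNat) atTop atTop :=
      tendsto_atTop.mpr fun n => (eventually_ge_atTop (n : ℤ)).mono fun a ha => by omega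
    exact h2.comp h1
  have hpos : ∀ᶠ p : ℕ × ℕ in longIntervals, (0 : ℤ) ≤ (p.2 : ℤ) - (p.1 : ℤ) :=
    tendsto_comap.eventually (eventually_ge_atTop 0)
  refine squeeze_zero' ?_ ?_ (hslow.comp hlen)
  · filter_upwards [hpos] with p hp
    have : (0 : ℝ) ≤ (p.2 : ℝ) - p.1 := by exact_mod_cast hp
    unfold intervalDensity
    positivity
  · filter_upwards [hpos] with p hp
    obtain ⟨M, N⟩ := p
    obtain ⟨n, rfl⟩ : ∃ n, N = M + n := ⟨N - M, by simp only at hp; omega⟩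
    have h := ncard_ones_le x.2 B j M (n + 1) fun r hr => by
      rw [← bdShift_iterate_apply]
      exact hr.2
    have hI : Set.Ico M (M + (n + 1)) = Set.Icc M (M + n) := by
      ext r
      simp only [Set.mem_Ico, Set.mem_Icc]
      omega
    have hn : (((M + n : ℕ) : ℤ) - (M : ℤ) + 1).toNat = n + 1 := by omega
    rw [hI] at h
    simp only [intervalDensity, Function.comp_apply, hn]
    have hd : ((M + n : ℕ) : ℝ) - (M : ℝ) + 1 = ((n + 1 : ℕ) : ℝ) := by
      push_cast
      ring
    rw [hd]
    gcongr

/-! ### The logarithmic example -/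

/-- The numbers of ones are integers, so a bound and its floor impose the same condition. -/
theorem boundedDensityShift_logFun :
    boundedDensityShift logFun = boundedDensityShift floorLogFun := by
  have key : ∀ s n : ℕ, (s : ℝ≥0) ≤ logFun n ↔ (s : ℝ≥0) ≤ floorLogFun n := by
    intro s n
    have h1 : (s : ℝ≥0) ≤ logFun n ↔ (s : ℝ) ≤ Real.logb 2 ((n : ℝ) + 1) := by
      rw [← NNReal.coe_le_coe]
      rfl
    rw [h1, floorLogFun, Nat.cast_le, Real.le_logb_iff_rpow_le one_lt_two (by positivity),
      Real.rpow_natCast, Nat.le_log_iff_pow_le one_lt_two (Nat.succ_ne_zero n)]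
    exact_mod_cast Iff.rfl
  ext x
  simp only [boundedDensityShift, Set.mem_ofPred_eq, key]

theorem isCanonical_floorLogFun : IsCanonical floorLogFun where
  zero := by simp [floorLogFun]
  step m := by
    obtain ⟨k, hk⟩ := Nat.exists_eq_add_of_le
      (Nat.log_mono_right (b := 2) (Nat.le_succ (m + 1)))
    exact ⟨k, by simp only [floorLogFun]; exact_mod_cast hk⟩
  subadd m n := by
    simp only [floorLogFun]
    norm_cast
    rcases Nat.eq_zero_or_pos m with rfl | hm
    · simp
    rcases Nat.eq_zero_or_pos n with rfl | hn
    · simp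
    -- With `a`, `b` the two logarithms, `a, b ≥ 1` makes both `m + 1` and `n + 1` less than `2 ^ (a
    -- + b)`, so `m + n + 1 < 2 ^ (a + b + 1)`.
    have ha : 1 ≤ Nat.log 2 (m + 1) := Nat.log_pos one_lt_two (by omega)
    have hb : 1 ≤ Nat.log 2 (n + 1) := Nat.log_pos one_lt_two (by omega)
    have hm' := Nat.lt_pow_succ_log_self one_lt_two (m + 1)
    have hn' := Nat.lt_pow_succ_log_self one_lt_two (n + 1)
    have h1 : 2 ^ (Nat.log 2 (m + 1) + 1) ≤ 2 ^ (Nat.log 2 (m + 1) + Nat.log 2 (n + 1)) :=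
      Nat.pow_le_pow_right two_pos (by omega)
    have h2 : 2 ^ (Nat.log 2 (n + 1) + 1) ≤ 2 ^ (Nat.log 2 (m + 1) + Nat.log 2 (n + 1)) :=
      Nat.pow_le_pow_right two_pos (by omega)
    refine Nat.le_of_lt_succ (Nat.log_lt_of_lt_pow (Nat.succ_ne_zero _) ?_)
    rw [Nat.succ_eq_add_one, pow_succ]
    omega

theorem not_bddAbove_floorLogFun : ¬ BddAbove (Set.range floorLogFun) := by
  rintro ⟨C, hC⟩
  obtain ⟨n, hn⟩ := exists_nat_gt C
  have h := hC ⟨2 ^ n - 1, rfl⟩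
  have hpow : 2 ^ n - 1 + 1 = 2 ^ n := Nat.sub_add_cancel Nat.one_le_two_pow
  rw [floorLogFun, hpow, Nat.log_pow one_lt_two] at h
  exact absurd h (not_le.mpr hn)

theorem tendsto_floorLogFun_div :
    Tendsto (fun n : ℕ => (floorLogFun n : ℝ) / n) atTop (𝓝 0) := by
  -- The factor 2 comes from `n ≥ (n + 1) / 2` for `n ≥ 1`, and `Real.log 2` from the change of
  -- base.
  have hlog : Tendsto (fun n : ℕ => 2 / Real.log 2 * (Real.log ((n + 1 : ℕ) : ℝ) / ((n + 1 : ℕ) : ℝ)))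
      atTop (𝓝 0) := by
    have h := (Real.isLittleO_log_id_atTop.tendsto_div_nhds_zero.comp
      (tendsto_natCast_atTop_atTop.comp (tendsto_add_atTop_nat 1))).const_mul (2 / Real.log 2)
    rw [mul_zero] at h
    exact h
  refine squeeze_zero' (Eventually.of_forall fun n => by positivity) ?_ hlog
  filter_upwards [eventually_ge_atTop 1] with n hn
  have hn' : (1 : ℝ) ≤ n := by exact_mod_cast hn
  have hl2 : 0 < Real.log 2 := Real.log_pos one_lt_two
  have hl : 0 ≤ Real.log ((n + 1 : ℕ) : ℝ) := Real.log_natCast_nonneg _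
  have h1 : ((floorLogFun n : ℝ≥0) : ℝ) ≤ Real.log ((n + 1 : ℕ) : ℝ) / Real.log 2 := by
    have := Real.natLog_le_logb (n + 1) 2
    simpa [floorLogFun, Real.logb] using this
  calc ((floorLogFun n : ℝ≥0) : ℝ) / n ≤ (Real.log ((n + 1 : ℕ) : ℝ) / Real.log 2) / n := by gcongr
    _ ≤ (Real.log ((n + 1 : ℕ) : ℝ) / Real.log 2) / (((n + 1 : ℕ) : ℝ) / 2) := by
        gcongr
        push_cast
        linarith
    _ = 2 / Real.log 2 * (Real.log ((n + 1 : ℕ) : ℝ) / ((n + 1 : ℕ) : ℝ)) := by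
        field_simp

theorem exists_isTransitivePoint_bdShift {f : ℕ → ℝ≥0} (hf : IsCanonical f)
    (hu : ¬ BddAbove (Set.range f)) : ∃ x, IsTransitivePoint (bdShift f) x := by
  have := compactSpace_boundedDensityShift f
  have : Nonempty (boundedDensityShift f) := ⟨zeroPoint f⟩
  exact (isStronglyMixing_bdShift hf hu).isTransitiveSystem.exists_isTransitivePoint
    (continuous_bdShift f)

theorem mainTheorem2 :
    -- every unbounded canonical function `f`
    (∀ f : ℕ → ℝ≥0, IsCanonical f → ¬ BddAbove (Set.range f) →
      HasMultipleIPRecurrence (bdShift f) ∧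
      IsStronglyMixing (bdShift f) ∧
      (∃ x, IsTransitivePoint (bdShift f) x) ∧
      (∀ x, IsTransitivePoint (bdShift f) x →
        ∀ U ∈ 𝓝 x, IsCSet (returnTimes (bdShift f) x U)) ∧
      -- if moreover `f` grows slowly
      (Tendsto (fun n : ℕ => (f n : ℝ) / n) atTop (𝓝 0) →
        (∀ x, Tendsto
          (fun n : ℕ =>
            ((returnTimes (bdShift f) x (oneCylinder f) ∩ Set.Icc 1 n).ncard : ℝ) / n)
          atTop (𝓝 0)) ∧
        (∀ μ : Measure (boundedDensityShift f), IsProbabilityMeasure μ →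
          (MeasurePreserving (bdShift f) μ μ ↔ μ = Measure.dirac (zeroPoint f))) ∧
        ¬ (boundedDensityShift f).Countable ∧
        ¬ IsESystem (bdShift f) ∧
        (∀ x, IsTransitivePoint (bdShift f) x →
          ∃ V ∈ 𝓝 x, HasBanachDensityZero (returnTimes (bdShift f) x V)))) ∧
    -- the example `log₂ (n + 1)`, whose canonical function is `⌊log₂ (n + 1)⌋`
    (boundedDensityShift logFun = boundedDensityShift floorLogFun ∧
      IsCanonical floorLogFun ∧ ¬ BddAbove (Set.range floorLogFun) ∧
      Tendsto (fun n : ℕ => (floorLogFun n : ℝ) / n) atTop (𝓝 0)) ∧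
    -- a C-set of Banach density zero
    (∃ A : Set ℕ, (∀ n ∈ A, 1 ≤ n) ∧ IsCSet A ∧ HasBanachDensityZero A) := by
  refine ⟨fun f hf hu => ⟨hasMultipleIPRecurrence_bdShift hf hu, isStronglyMixing_bdShift hf hu,
    exists_isTransitivePoint_bdShift hf hu, fun x hx U hU =>
      (hasMultipleIPRecurrence_bdShift hf hu).isCSet_returnTimes (continuous_bdShift f)
        (surjective_bdShift hf) hx hU,
    fun hslow => ⟨tendsto_ncard_returnTimes_div hslow,
      fun μ _ => measurePreserving_bdShift_iff hslow μ,
      not_countable_boundedDensityShift hf hu, not_isESystem_bdShift hf hu hslow,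
      fun x hx => exists_nhds_hasBanachDensityZero hf hu hslow hx⟩⟩,
    ⟨boundedDensityShift_logFun, isCanonical_floorLogFun, not_bddAbove_floorLogFun,
      tendsto_floorLogFun_div⟩, ?_⟩
  -- The C-set property holds for every neighbourhood of a transitive point, in particular for the
  -- one whose return times have Banach density zero.
  have hf := isCanonical_floorLogFun
  have hu := not_bddAbove_floorLogFun
  obtain ⟨x, hx⟩ := exists_isTransitivePoint_bdShift hf hu
  obtain ⟨V, hV, hV0⟩ := exists_nhds_hasBanachDensityZero hf hu tendsto_floorLogFun_div hx
  exact ⟨_, fun n hn => hn.1, (hasMultipleIPRecurrence_bdShift hf hu).isCSet_returnTimes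
    (continuous_bdShift _) (surjective_bdShift hf) hx hV, hV0⟩
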